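/- Let $(A,X,U,Y(0),Y(1))$ be a random record with law $Q$ (the superpopulation): $A\in\{0,1\}$ is a binary treatment, $X,U$ are covariates, $Y(0),Y(1)$ are real potential outcomes, $Y=AY(1)+(1-A)Y(0)$ is the observed outcome, and $\tau=E\{Y(1)-Y(0)\}$, assumed to exist, is the average causal effect. Consider a sequence of studies, defined on a common probability space. Each has a main sample $\mathcal S_1$ of $n_1$ units whose records are i.i.d. with law $Q$, and a validation sample $\mathcal S_2\subset\mathcal S_1$ of $n_2$ units which is a simple random sample (without replacement) from $\mathcal S_1$, drawn independently of the records. Along the sequence $n_2\to\infty$ and $n_2/n_1\to\rho$ (so $\rho\in[0,1]$). Write $A_n\cong B_n$ if $A_n=B_n+o_P(n^{-1/2})$. Let $\hat\tau_2$ (real valued) and $\hat\tau_{1,\mathrm{ep}},\hat\tau_{2,\mathrm{ep}}$ ($\mathbb R^L$ valued) be estimators which are asymptotically linear, i.e. $$\hat\tau_2-\tau\cong n_2^{-1}\sum_{j\in\mathcal S_2}\psi(A_j,X_j,U_j,Y_j),\qquad \hat\tau_{d,\mathrm{ep}}-\tau_{\mathrm{ep}}\cong n_d^{-1}\sum_{j\in\mathcal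 S_d}\phi(A_j,X_j,Y_j)\quad(d=1,2),$$ where the remainders are $o_P(n_2^{-1/2})$ and $o_P(n_d^{-1/2})$ respectively, $\tau_{\mathrm{ep}}\in\mathbb R^L$ is a constant vector, and the influence functions $\psi$ (real valued) and $\phi$ ($\mathbb R^L$ valued) satisfy $E\{\psi(A,X,U,Y)\}=0$, $E\{\phi(A,X,Y)\}=0$, $E\{\psi(A,X,U,Y)^2\}<\infty$ and $E\{\|\phi(A,X,Y)\|^2\}<\infty$. Put $$v_2=\mathrm{var}\{\psi(A,X,U,Y)\},\quad \Gamma=(1-\rho)\,\mathrm{cov}\{\psi(A,X,U,Y),\phi(A,X,Y)\}\in\mathbb R^L,\quad V=(1-\rho)\,\mathrm{var}\{\phi(A,X,Y)\}\in\mathbb R^{L\times L}.$$ Then the matrix $\begin{pmatrix}v_2&\Gamma^{\mathrm T}\\ \Gamma&V\end{pmatrix}$ is positive semidefinite, and $$n_2^{1/2}\begin{pmatrix}\hat\tau_2-\tau\\ \hat\tau_{2,\mathrm{ep}}-\hat\tau_{1,\mathrm{ep}}\end{pmatrix}\longrightarrow\mathcal N\left\{0_{L+1},\begin{pmatrix}v_2&\Gamma^{\mathrm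 T}\\ \Gamma&V\end{pmatrix}\right\}$$ in distribution (the normal law may be degenerate). -/

import Mathlib

open MeasureTheory ProbabilityTheory Filter Topology
open scoped ENNReal

namespace TwoSource

/-- The complete record `(A, X, U, Y(0), Y(1))` of a unit: binary treatment, covariates `X` and `U`,
and the two potential outcomes. -/
abbrev Record (𝒳 𝒰 : Type*) : Type _ := Bool × 𝒳 × 𝒰 × ℝ × ℝ

section Records

variable {𝒳 𝒰 : Type*}

/-- The potential outcome `Y(0)`. -/
def outcome0 (w : Record 𝒳 𝒰) : ℝ := w.2.2.2.1

/-- The potential outcome `Y(1)`. -/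
def outcome1 (w : Record 𝒳 𝒰) : ℝ := w.2.2.2.2

/-- The observed outcome `Y = Y(A) = A Y(1) + (1 - A) Y(0)`. -/
def outcome (w : Record 𝒳 𝒰) : ℝ := if w.1 then outcome1 w else outcome0 w

/-- The data `(A, X, U, Y)` observed on a unit of the validation sample. -/
def fullObs (w : Record 𝒳 𝒰) : Bool × 𝒳 × 𝒰 × ℝ := (w.1, w.2.1, w.2.2.1, outcome w)

/-- The data `(A, X, Y)` observed on every unit of the main sample. -/
def commonObs (w : Record 𝒳 𝒰) : Bool × 𝒳 × ℝ := (w.1, w.2.1, outcome w)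

/-- The average causal effect `τ = E{Y(1) - Y(0)}` in the superpopulation `Q`. -/
noncomputable def averageCausalEffect [MeasurableSpace 𝒳] [MeasurableSpace 𝒰]
    (Q : Measure (Record 𝒳 𝒰)) : ℝ :=
  ∫ w, (outcome1 w - outcome0 w) ∂Q

end Records

/-- The units `W 0, …, W (N - 1)` are independent, each with law `Q`. -/
structure IsIIDSample {Ω R : Type*} [MeasurableSpace Ω] [MeasurableSpace R] (P : Measure Ω)
    (Q : Measure R) {N : ℕ} (W : Fin N → Ω → R) : Prop where
  hasLaw : ∀ i, HasLaw (W i) Q P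
  indep : iIndepFun W P

/-- `S` is a simple random sample (without replacement) of `n` of the `N` units `W`: all subsets of
size `n` are equally likely, no other subset is drawn, and the draw is independent of the values
carried by the units. -/
structure IsSimpleRandomSample {Ω R : Type*} [MeasurableSpace Ω] [MeasurableSpace R]
    (P : Measure Ω) {N : ℕ} (n : ℕ) (S : Ω → Finset (Fin N)) (W : Fin N → Ω → R) : Prop where
  measurableSet_eq : ∀ s, MeasurableSet {ω | S ω = s}
  prob_eq : ∀ s, P {ω | S ω = s} = if s.card = n then (N.choose n : ℝ≥0∞)⁻¹ else 0
  indep : Indep (MeasurableSpace.comap S ⊤)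
    (MeasurableSpace.comap (fun ω i ↦ W i ω) MeasurableSpace.pi) P

/-- `A ≅ B` along sample sizes `n k`: `A k = B k + o_P((n k) ^ (-1/2))`. -/
def AsympEquiv {Ω E : Type*} [MeasurableSpace Ω] [NormedAddCommGroup E] [NormedSpace ℝ E]
    (P : Measure Ω) (n : ℕ → ℕ) (A B : ℕ → Ω → E) : Prop :=
  TendstoInMeasure P (fun k ω ↦ √(n k : ℝ) • (A k ω - B k ω)) atTop (fun _ ↦ 0)

/-- The estimators `est k` of `θ` are asymptotically linear with influence function `χ`: the
function `χ` of the observed part `obs` of a record has mean zero and a finite second moment in the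
superpopulation `Q`, and `est k - θ ≅ (n k)⁻¹ ∑_{j ∈ S k} χ (obs (W k j))`, where `S k` is the
(possibly random) set of the units used, of size `n k`. -/
structure IsAsympLinear {Ω R D E : Type*} [MeasurableSpace Ω] [MeasurableSpace R]
    [MeasurableSpace D] [NormedAddCommGroup E] [NormedSpace ℝ E] [MeasurableSpace E]
    (P : Measure Ω) (Q : Measure R) {N : ℕ → ℕ} (W : (k : ℕ) → Fin (N k) → Ω → R)
    (n : ℕ → ℕ) (S : (k : ℕ) → Ω → Finset (Fin (N k))) (obs : R → D) (χ : D → E)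
    (θ : E) (est : ℕ → Ω → E) : Prop where
  aemeasurable_est : ∀ k, AEMeasurable (est k) P
  measurable_influence : Measurable χ
  memLp_influence : MemLp (fun w ↦ χ (obs w)) 2 Q
  mean_influence : ∫ w, χ (obs w) ∂Q = 0
  expansion : AsympEquiv P n (fun k ω ↦ est k ω - θ)
    (fun k ω ↦ (n k : ℝ)⁻¹ • ∑ j ∈ S k ω, χ (obs (W k j ω)))

section Limit

variable {𝒳 𝒰 : Type*} [MeasurableSpace 𝒳] [MeasurableSpace 𝒰] {L : ℕ}

/-- `v₂ = var{ψ(A, X, U, Y)}`. -/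
noncomputable def limitV2 (Q : Measure (Record 𝒳 𝒰)) (ψ : Bool × 𝒳 × 𝒰 × ℝ → ℝ) : ℝ :=
  Var[fun w ↦ ψ (fullObs w); Q]

/-- `Γ = (1 - ρ) cov{ψ(A, X, U, Y), φ(A, X, Y)}`, a vector of length `L`. -/
noncomputable def limitΓ (Q : Measure (Record 𝒳 𝒰)) (ρ : ℝ) (ψ : Bool × 𝒳 × 𝒰 × ℝ → ℝ)
    (φ : Bool × 𝒳 × ℝ → EuclideanSpace ℝ (Fin L)) (l : Fin L) : ℝ :=
  (1 - ρ) * cov[fun w ↦ ψ (fullObs w), fun w ↦ φ (commonObs w) l; Q]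

/-- `V = (1 - ρ) var{φ(A, X, Y)}`, an `L × L` matrix. -/
noncomputable def limitV (Q : Measure (Record 𝒳 𝒰)) (ρ : ℝ)
    (φ : Bool × 𝒳 × ℝ → EuclideanSpace ℝ (Fin L)) : Matrix (Fin L) (Fin L) ℝ :=
  Matrix.of fun l m ↦ (1 - ρ) * cov[fun w ↦ φ (commonObs w) l, fun w ↦ φ (commonObs w) m; Q]

end Limit

/-- The block matrix with rows `(v, Γᵀ)` and `(Γ, V)`. -/
def jointCov {L : ℕ} (v : ℝ) (Γ : Fin L → ℝ) (V : Matrix (Fin L) (Fin L) ℝ) :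
    Matrix (Unit ⊕ Fin L) (Unit ⊕ Fin L) ℝ :=
  Matrix.fromBlocks (Matrix.of fun _ _ ↦ v) (Matrix.replicateRow Unit Γ)
    (Matrix.replicateCol Unit Γ) V

/-- The vector of length `L + 1` with first entry `a` and remaining entries `b`. -/
noncomputable def stack {L : ℕ} (a : ℝ) (b : EuclideanSpace ℝ (Fin L)) :
    EuclideanSpace ℝ (Unit ⊕ Fin L) :=
  WithLp.toLp 2 (Sum.elim (fun _ ↦ a) (fun l ↦ b l))

end TwoSource

open TwoSource

/-!
After the expansions are inserted, the vector under study differs by `o_P(1)` from the linear part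
`√n₂ • (n₂⁻¹ ∑_{S₂} ψ, n₂⁻¹ ∑_{S₂} φ - n₁⁻¹ ∑_{S₁} φ)`; the remainder of the main sample is of
order `o_P(n₁^(-1/2))`, which is enough because `n₂ ≤ n₁`. By Slutsky's theorem it remains to find
the limit law of the linear part, and by Lévy's theorem this can be read off from characteristic
functions.

A scalar projection of the linear part is `√n₂ (n₂⁻¹ ∑_{S₂} f - n₁⁻¹ ∑_{S₁} g)` with centred `f` and
`g` in `L²(Q)`. Since `S₂` is independent of the records and these are i.i.d., the characteristic
function of this variable is the same for every value of `S₂` of size `n₂`, and with `r = n₂ / n₁`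
it factors (`TwoSource.IsSimpleRandomSample.integral_eq`, `TwoSource.IsIIDSample.integral_exp_sum`)
as `(E exp(i n₂^(-1/2) (f - r g)))^n₂ * (E exp(-i n₂^(-1/2) r g))^(n₁ - n₂)`:
a validation unit contributes to both sums, any other unit to the second one only. The summands
depend on `k` through `r`, and `n₁ - n₂` need not tend to infinity, so the limits of both powers
are taken from a row-wise central limit theorem (`tendsto_integral_exp_pow`), proved by dominated
convergence from the second order expansion of the exponential. The first power yields the variance
`E (f - ρ g)²`, the second one `ρ (1 - ρ) E g²`, as `(n₁ - n₂) r² / n₂ = r (1 - r)`.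

With `f = a ψ + g` and `g = ⟪φ, y⟫` the sum of these two variances is the quadratic form of the
limiting covariance matrix at `(a, y)` (`dotProduct_jointCov_mulVec`). In this form it is
visibly nonnegative for `ρ ∈ [0, 1]`, which also gives positive semidefiniteness.
-/

/-! ### Limits of powers of characteristic functions -/

/-- The exponents `m k` are arbitrary: they need not tend to infinity, hence the separate
hypothesis `z → 0`. -/
theorem tendsto_one_add_pow_exp_of_tendsto_mul {m : ℕ → ℕ} {z : ℕ → ℂ} {c : ℂ}
    (hz : Tendsto z atTop (𝓝 0)) (hmz : Tendsto (fun k ↦ (m k : ℂ) * z k) atTop (𝓝 c)) :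
    Tendsto (fun k ↦ (1 + z k) ^ m k) atTop (𝓝 (Complex.exp c)) := by
  have hlog : (fun w : ℂ ↦ Complex.log (1 + w) - w) =o[𝓝 0] fun w ↦ w := by
    have := (Complex.hasDerivAt_log (z := 1) (by simp)).isLittleO
    have := this.comp_tendsto (k := fun w : ℂ ↦ 1 + w)
      ((continuous_const.add continuous_id).tendsto' (0 : ℂ) 1 (by simp))
    refine this.congr (fun w ↦ ?_) fun w ↦ ?_ <;> simp
  have h0 : Tendsto (fun k ↦ (m k : ℂ) * (Complex.log (1 + z k) - z k)) atTop (𝓝 0) := by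
    have h1 := (Asymptotics.isBigO_refl (fun k ↦ (m k : ℂ)) atTop).mul_isLittleO
      (hlog.comp_tendsto hz)
    exact (Asymptotics.isLittleO_one_iff ℂ).1 (h1.trans_isBigO (hmz.isBigO_one ℂ))
  have h2 : Tendsto (fun k ↦ (m k : ℂ) * Complex.log (1 + z k)) atTop (𝓝 c) := by
    simpa [mul_sub] using h0.add hmz
  refine ((Complex.continuous_exp.tendsto c).comp h2).congr' ?_
  filter_upwards [hz.eventually_ne (show (0 : ℂ) ≠ -1 by simp)] with k hk
  have : 1 + z k ≠ 0 := fun h ↦ hk (by linear_combination h)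
  simp [Complex.exp_nat_mul, Complex.exp_log this]

theorem norm_exp_mul_I_sub_one_sub_le (x : ℝ) :
    ‖Complex.exp (x * Complex.I) - 1 - x * Complex.I‖ ≤ 3 * x ^ 2 := by
  have hx : ‖(x * Complex.I : ℂ)‖ = |x| := by simp
  rcases le_or_gt |x| 1 with h | h
  · have := Complex.norm_exp_sub_one_sub_id_le (hx.trans_le h)
    rw [hx, sq_abs] at this
    nlinarith [sq_nonneg x]
  · calc _ ≤ ‖Complex.exp (x * Complex.I)‖ + ‖(1 : ℂ)‖ + ‖(x * Complex.I : ℂ)‖ :=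
          (norm_sub_le _ _).trans (by gcongr; exact norm_sub_le _ _)
      _ = 2 + |x| := by rw [Complex.norm_exp_ofReal_mul_I, hx]; norm_num
      _ ≤ 3 * x ^ 2 := by rw [← sq_abs x]; nlinarith

theorem tendsto_mul_exp_mul_I_sub_one_sub {m : ℕ → ℕ} {x : ℕ → ℝ} {d : ℝ}
    (hx : Tendsto x atTop (𝓝 0)) (hmx : Tendsto (fun k ↦ (m k : ℝ) * x k ^ 2) atTop (𝓝 d)) :
    Tendsto (fun k ↦ (m k : ℂ) * (Complex.exp (x k * Complex.I) - 1 - x k * Complex.I)) atTop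
      (𝓝 (-(d / 2))) := by
  have hxI : Tendsto (fun k ↦ (x k * Complex.I : ℂ)) atTop (𝓝 0) := by
    simpa using ((Complex.continuous_ofReal.tendsto 0).comp hx).mul_const Complex.I
  have h1 := (Asymptotics.isBigO_refl (fun k ↦ (m k : ℂ)) atTop).mul_isLittleO
      ((Complex.exp_sub_sum_range_succ_isLittleO_pow 2).comp_tendsto hxI)
  have hc : Tendsto (fun k ↦ (m k : ℂ) * (x k * Complex.I) ^ 2) atTop (𝓝 (-d)) := by
    have := ((Complex.continuous_ofReal.tendsto d).comp hmx).neg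
    refine this.congr fun k ↦ ?_
    simp [mul_pow]
  have h0 := (Asymptotics.isLittleO_one_iff ℂ).1 (h1.trans_isBigO (hc.isBigO_one ℂ))
  have := h0.add (hc.div_const 2)
  rw [zero_add, neg_div] at this
  refine this.congr fun k ↦ ?_
  simp [Finset.sum_range_succ]
  ring

/-- A row-wise central limit theorem in terms of characteristic functions: the `k`-th row
consists of `m k` independent copies of the centred variable `h k`, scaled by `t k`, and `h k`
converges pointwise to `h'` under a square integrable bound. -/
theorem tendsto_integral_exp_pow {R : Type*} [MeasurableSpace R] {Q : Measure R}
    [IsProbabilityMeasure Q] {m : ℕ → ℕ} {t : ℕ → ℝ} {c : ℝ} {h : ℕ → R → ℝ} {h' H : R → ℝ}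
    (ht : Tendsto t atTop (𝓝 0)) (hmt : Tendsto (fun k ↦ (m k : ℝ) * t k ^ 2) atTop (𝓝 c))
    (hmeas : ∀ k, AEStronglyMeasurable (h k) Q) (hH : MemLp H 2 Q)
    (hle : ∀ᶠ k in atTop, ∀ w, |h k w| ≤ H w)
    (hlim : ∀ w, Tendsto (fun k ↦ h k w) atTop (𝓝 (h' w))) (hmean : ∀ k, ∫ w, h k w ∂Q = 0) :
    Tendsto (fun k ↦ (∫ w, Complex.exp ((t k * h k w : ℝ) * Complex.I) ∂Q) ^ m k) atTop
      (𝓝 (Complex.exp ((-(c * (∫ w, h' w ^ 2 ∂Q) / 2) : ℝ)))) := by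
  have hHsq : Integrable (fun w ↦ H w ^ 2) Q := hH.integrable_sq
  have hexp (k) : Integrable (fun w ↦ Complex.exp ((t k * h k w : ℝ) * Complex.I)) Q := by
    refine .of_bound ?_ 1 (.of_forall fun w ↦ (Complex.norm_exp_ofReal_mul_I _).le)
    exact (by fun_prop : Continuous fun y : ℝ ↦ Complex.exp ((t k * y : ℝ) * Complex.I))
      |>.comp_aestronglyMeasurable (hmeas k)
  have hint : ∀ᶠ k in atTop, ∫ w, Complex.exp ((t k * h k w : ℝ) * Complex.I) ∂Q - 1 =
      ∫ w, (Complex.exp ((t k * h k w : ℝ) * Complex.I) - 1 -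
        (t k * h k w : ℝ) * Complex.I) ∂Q := by
    filter_upwards [hle] with k hk
    have hh : Integrable (h k) Q := (hH.integrable (by norm_num)).mono (hmeas k)
      (.of_forall fun w ↦ by simpa using (hk w).trans (le_abs_self _))
    have h2 : Integrable (fun w ↦ ((t k * h k w : ℝ) : ℂ) * Complex.I) Q :=
      ((hh.const_mul _).ofReal).mul_const _
    -- the linear term integrates to zero because `h k` is centred
    rw [integral_sub (f := fun w ↦ Complex.exp ((t k * h k w : ℝ) * Complex.I) - 1)
        ((hexp k).sub (integrable_const _)) h2,
      integral_sub (hexp k) (integrable_const _), integral_mul_const, integral_complex_ofReal,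
      integral_const_mul, hmean k]
    simp
  -- used with `a = m` for the exponent, and with `a = 1` to see that the base tends to `1`
  have key (a : ℕ → ℕ) (e : ℝ) (ha : Tendsto (fun k ↦ (a k : ℝ) * t k ^ 2) atTop (𝓝 e)) :
      Tendsto (fun k ↦ (a k : ℂ) * (∫ w, Complex.exp ((t k * h k w : ℝ) * Complex.I) ∂Q - 1))
        atTop (𝓝 ((-(e * (∫ w, h' w ^ 2 ∂Q) / 2) : ℝ))) := by
    have hlim0 : Tendsto (fun k ↦ ∫ w, (a k : ℂ) *
        (Complex.exp ((t k * h k w : ℝ) * Complex.I) - 1 - (t k * h k w : ℝ) * Complex.I) ∂Q) atTop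
        (𝓝 (∫ w, -(((e * h' w ^ 2 : ℝ) : ℂ) / 2) ∂Q)) := by
      refine tendsto_integral_filter_of_dominated_convergence
        (fun w ↦ 3 * (|e| + 1) * H w ^ 2) (.of_forall fun k ↦ ?_) ?_ (hHsq.const_mul _)
        (.of_forall fun w ↦ ?_)
      · exact (by fun_prop : Continuous fun y : ℝ ↦ (a k : ℂ) *
          (Complex.exp ((t k * y : ℝ) * Complex.I) - 1 - (t k * y : ℝ) * Complex.I))
          |>.comp_aestronglyMeasurable (hmeas k)
      · filter_upwards [hle, ha.eventually_le_const
          ((le_abs_self e).trans_lt (lt_add_one |e|))] with k hk hak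
        refine .of_forall fun w ↦ ?_
        rw [norm_mul, Complex.norm_natCast]
        have h1 := norm_exp_mul_I_sub_one_sub_le (t k * h k w)
        have h2 : h k w ^ 2 ≤ H w ^ 2 := sq_le_sq.2 ((hk w).trans (le_abs_self _))
        calc _ ≤ (a k : ℝ) * (3 * (t k * h k w) ^ 2) := by gcongr
          _ = 3 * ((a k : ℝ) * t k ^ 2) * h k w ^ 2 := by ring
          _ ≤ _ := by gcongr
      · refine tendsto_mul_exp_mul_I_sub_one_sub ?_ ?_
        · simpa using ht.mul (hlim w)
        · exact (ha.mul ((hlim w).pow 2)).congr fun k ↦ by ring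
    have : ∫ w, -(((e * h' w ^ 2 : ℝ) : ℂ) / 2) ∂Q = ((-(e * (∫ w, h' w ^ 2 ∂Q) / 2) : ℝ) : ℂ) := by
      rw [integral_neg, integral_div, integral_complex_ofReal, integral_const_mul]
      push_cast
      rfl
    rw [← this]
    refine hlim0.congr' ?_
    filter_upwards [hint] with k hk
    rw [hk, integral_const_mul]
  have hz : Tendsto (fun k ↦ ∫ w, Complex.exp ((t k * h k w : ℝ) * Complex.I) ∂Q - 1) atTop
      (𝓝 0) := by
    have := key (fun _ ↦ 1) 0 (by simpa using ht.pow 2)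
    simpa using this
  have := tendsto_one_add_pow_exp_of_tendsto_mul hz (key m c hmt)
  simpa using this

/-! ### Simple random samples of independent units -/

/-- The draw can be conditioned out: if the integral of `G s (W)` has the same value `c` for every
fixed subset `s` of the prescribed size, then it has this value for the random subset, too. -/
theorem TwoSource.IsSimpleRandomSample.integral_eq {Ω R : Type*} [MeasurableSpace Ω]
    [MeasurableSpace R] {P : Measure Ω} [IsProbabilityMeasure P] {N n : ℕ} {S : Ω → Finset (Fin N)}
    {W : Fin N → Ω → R} (hS : IsSimpleRandomSample P n S W) (hW : ∀ i, AEMeasurable (W i) P)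
    {G : Finset (Fin N) → (Fin N → R) → ℂ} {c : ℂ} {C : ℝ}
    (hG : ∀ s, Measurable (G s)) (hC : ∀ s x, ‖G s x‖ ≤ C)
    (hc : ∀ s : Finset (Fin N), s.card = n → ∫ ω, G s (fun i ↦ W i ω) ∂P = c) :
    ∫ ω, G (S ω) (fun i ↦ W i ω) ∂P = c := by
  classical
  have hWm : AEMeasurable (fun ω i ↦ W i ω) P := aemeasurable_pi_lambda _ hW
  let _ : MeasurableSpace (Finset (Fin N)) := ⊤
  have hI : IndepFun S (fun ω i ↦ W i ω) P := hS.indep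
  have hsplit (ω : Ω) : G (S ω) (fun i ↦ W i ω) =
      ∑ s, (if S ω = s then (1 : ℂ) else 0) * G s (fun i ↦ W i ω) := by
    simp
  have hind (s) : AEStronglyMeasurable (fun ω ↦ if S ω = s then (1 : ℂ) else 0) P :=
    (Measurable.ite (hS.measurableSet_eq s) measurable_const measurable_const).aestronglyMeasurable
  have hGm (s) : AEStronglyMeasurable (fun ω ↦ G s (fun i ↦ W i ω)) P :=
    ((hG s).comp_aemeasurable hWm).aestronglyMeasurable
  have hprod (s) : Integrable
      (fun ω ↦ (if S ω = s then (1 : ℂ) else 0) * G s (fun i ↦ W i ω)) P := by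
    refine .of_bound ((hind s).mul (hGm s)) C (.of_forall fun ω ↦ ?_)
    have := hC s (fun i ↦ W i ω)
    have := norm_nonneg (G s (fun i ↦ W i ω))
    split_ifs <;> simp <;> linarith
  have hone (s : Finset (Fin N)) :
      ∫ ω, (if S ω = s then (1 : ℂ) else 0) ∂P = P.real {ω | S ω = s} := by
    have := integral_indicator_one (μ := P) (hS.measurableSet_eq s)
    rw [← this, ← integral_complex_ofReal]
    congr with ω
    by_cases h : S ω = s <;> simp [h]
  have hfac (s : Finset (Fin N)) : ∫ ω, (if S ω = s then (1 : ℂ) else 0) * G s (fun i ↦ W i ω) ∂P =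
      (P.real {ω | S ω = s} : ℂ) * c := by
    have h1 : IndepFun (fun ω ↦ if S ω = s then (1 : ℂ) else 0) (fun ω ↦ G s (fun i ↦ W i ω)) P :=
      hI.comp (φ := fun s' ↦ if s' = s then (1 : ℂ) else 0) measurable_from_top (hG s)
    rw [h1.integral_fun_mul_eq_mul_integral (hind s) (hGm s), hone]
    by_cases hs : s.card = n
    · rw [hc s hs]
    · have : P.real {ω | S ω = s} = 0 := by simp [Measure.real, hS.prob_eq, hs]
      simp [this]
  have htot : ∑ s, (P.real {ω | S ω = s} : ℂ) = 1 := by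
    simp_rw [← hone]
    rw [← integral_finsetSum]
    · simp
    · intro s _
      exact .of_bound (hind s) 1 (.of_forall fun ω ↦ by split_ifs <;> simp)
  simp_rw [hsplit]
  rw [integral_finsetSum _ fun s _ ↦ hprod s]
  simp_rw [hfac]
  rw [← Finset.sum_mul, htot, one_mul]

/-- The characteristic function of a sum in which the units of a fixed set `s` contribute through
`a` and the others through `b`. It depends on `s` only through its size. -/
theorem TwoSource.IsIIDSample.integral_exp_sum {Ω R : Type*} [MeasurableSpace Ω] [MeasurableSpace R]
    {P : Measure Ω} {Q : Measure R} {N : ℕ} {W : Fin N → Ω → R} (hW : IsIIDSample P Q W)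
    {a b : R → ℝ} (ha : Measurable a) (hb : Measurable b) (s : Finset (Fin N)) :
    ∫ ω, Complex.exp ((∑ j, if j ∈ s then a (W j ω) else b (W j ω) : ℝ) * Complex.I) ∂P =
      (∫ w, Complex.exp (a w * Complex.I) ∂Q) ^ s.card *
        (∫ w, Complex.exp (b w * Complex.I) ∂Q) ^ (N - s.card) := by
  have hf (j : Fin N) : Measurable
      (fun w ↦ Complex.exp ((if j ∈ s then a w else b w : ℝ) * Complex.I)) := by
    split_ifs <;> fun_prop
  have := hW.indep.integral_fun_prod_comp (fun j ↦ (hW.hasLaw j).aemeasurable)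
    (f := fun j w ↦ Complex.exp ((if j ∈ s then a w else b w : ℝ) * Complex.I))
    (fun j ↦ (hf j).aestronglyMeasurable)
  simp_rw [Complex.ofReal_sum, Finset.sum_mul, Complex.exp_sum]
  rw [this]
  have hj (j : Fin N) :
      ∫ ω, Complex.exp ((if j ∈ s then a (W j ω) else b (W j ω) : ℝ) * Complex.I) ∂P =
        if j ∈ s then ∫ w, Complex.exp (a w * Complex.I) ∂Q
        else ∫ w, Complex.exp (b w * Complex.I) ∂Q := by
    have := (hW.hasLaw j).integral_comp (hf j).aestronglyMeasurable
    simp only [Function.comp_def] at this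
    rw [this]
    split_ifs <;> rfl
  simp_rw [hj]
  rw [Finset.prod_ite]
  simp [Finset.filter_not, Finset.card_sdiff]

/-- Otherwise no subset of size `n` exists and every value of `S` has probability zero. -/
theorem TwoSource.IsSimpleRandomSample.card_le {Ω R : Type*} [MeasurableSpace Ω]
    [MeasurableSpace R] {P : Measure Ω} [IsProbabilityMeasure P] {N n : ℕ} {S : Ω → Finset (Fin N)}
    {W : Fin N → Ω → R} (hS : IsSimpleRandomSample P n S W) : n ≤ N := by
  by_contra! h
  have h0 (s : Finset (Fin N)) : P {ω | S ω = s} = 0 := by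
    rw [hS.prob_eq, if_neg]
    have := s.card_le_univ
    simp at this
    omega
  have h1 : P (⋃ s, {ω | S ω = s}) = 0 := measure_iUnion_null h0
  have h2 : (⋃ s, {ω | S ω = s}) = Set.univ := by ext; simp
  simp [h2] at h1

theorem TwoSource.IsSimpleRandomSample.aemeasurable_sum {Ω R E : Type*} [MeasurableSpace Ω]
    [MeasurableSpace R] {P : Measure Ω} [AddCommMonoid E] [MeasurableSpace E] [MeasurableAdd₂ E]
    {N n : ℕ}
    {S : Ω → Finset (Fin N)} {W : Fin N → Ω → R} (hS : IsSimpleRandomSample P n S W)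
    (hW : ∀ i, AEMeasurable (W i) P) {χ : R → E} (hχ : Measurable χ) :
    AEMeasurable (fun ω ↦ ∑ j ∈ S ω, χ (W j ω)) P := by
  classical
  have hmem (j : Fin N) : MeasurableSet {ω | j ∈ S ω} := by
    have : {ω | j ∈ S ω} = ⋃ s ∈ {s : Finset (Fin N) | j ∈ s}, {ω | S ω = s} := by
      ext ω
      simp
    rw [this]
    exact .biUnion (Set.to_countable _) fun s _ ↦ hS.measurableSet_eq s
  have : (fun ω ↦ ∑ j ∈ S ω, χ (W j ω)) =
      fun ω ↦ ∑ j, {ω | j ∈ S ω}.indicator (fun ω ↦ χ (W j ω)) ω := by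
    ext ω
    simp [Set.indicator_apply]
  rw [this]
  exact Finset.aemeasurable_fun_sum _ fun j _ ↦ (hχ.comp_aemeasurable (hW j)).indicator (hmem j)

/-- The scalar limit theorem: the characteristic function, at `1`, of
`√n₂ (n₂⁻¹ ∑_{S} f - n₁⁻¹ ∑ g)` tends to that of a centred normal law with variance
`E (f - ρ g)² + ρ (1 - ρ) E g²`. -/
theorem tendsto_integral_exp_subsample {Ω R : Type*} [MeasurableSpace Ω] [MeasurableSpace R]
    {P : Measure Ω} [IsProbabilityMeasure P] {Q : Measure R} [IsProbabilityMeasure Q]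
    {n₁ n₂ : ℕ → ℕ} (hn₂ : Tendsto n₂ atTop atTop) {ρ : ℝ}
    (hρ : Tendsto (fun k ↦ (n₂ k : ℝ) / (n₁ k : ℝ)) atTop (𝓝 ρ))
    {W : (k : ℕ) → Fin (n₁ k) → Ω → R} (hW : ∀ k, IsIIDSample P Q (W k))
    {S : (k : ℕ) → Ω → Finset (Fin (n₁ k))} (hS : ∀ k, IsSimpleRandomSample P (n₂ k) (S k) (W k))
    {f g : R → ℝ} (hf : Measurable f) (hg : Measurable g) (hf2 : MemLp f 2 Q) (hg2 : MemLp g 2 Q)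
    (hf0 : ∫ w, f w ∂Q = 0) (hg0 : ∫ w, g w ∂Q = 0) :
    Tendsto (fun k ↦ ∫ ω, Complex.exp ((√(n₂ k : ℝ) * ((n₂ k : ℝ)⁻¹ * ∑ j ∈ S k ω, f (W k j ω) -
        (n₁ k : ℝ)⁻¹ * ∑ j, g (W k j ω)) : ℝ) * Complex.I) ∂P) atTop
      (𝓝 (Complex.exp ((-((∫ w, (f w - ρ * g w) ^ 2 ∂Q +
        ρ * (1 - ρ) * ∫ w, g w ^ 2 ∂Q) / 2) : ℝ)))) := by
  have hle (k) : n₂ k ≤ n₁ k := (hS k).card_le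
  set r : ℕ → ℝ := fun k ↦ (n₂ k : ℝ) / (n₁ k : ℝ) with hr
  have hr0 (k) : 0 ≤ r k := by positivity
  have hr1 (k) : r k ≤ 1 := div_le_one_of_le₀ (mod_cast hle k) (by positivity)
  set a : ℕ → ℝ := fun k ↦ (√(n₂ k : ℝ))⁻¹ with ha
  -- both identities hold for `n₂ k = 0`, where all terms vanish
  have hsq (k) : √(n₂ k : ℝ) * (n₂ k : ℝ)⁻¹ = a k := by
    rw [← div_eq_mul_inv, Real.sqrt_div_self', one_div]
  have hsq' (k) : √(n₂ k : ℝ) * (n₁ k : ℝ)⁻¹ = a k * r k := by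
    rw [hr, ha]
    simp only
    rw [inv_mul_eq_div, div_right_comm, Real.div_sqrt, div_eq_mul_inv]
  have hn₂' : Tendsto (fun k ↦ (n₂ k : ℝ)) atTop atTop := tendsto_natCast_atTop_atTop.comp hn₂
  have ha0 : Tendsto a atTop (𝓝 0) :=
    tendsto_inv_atTop_zero.comp (Real.tendsto_sqrt_atTop.comp hn₂')
  -- a unit in the validation sample carries `a (f - r g)`, any other unit `-a r g`
  have hfactor (k) : ∫ ω, Complex.exp ((√(n₂ k : ℝ) * ((n₂ k : ℝ)⁻¹ * ∑ j ∈ S k ω, f (W k j ω) -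
        (n₁ k : ℝ)⁻¹ * ∑ j, g (W k j ω)) : ℝ) * Complex.I) ∂P =
      (∫ w, Complex.exp ((a k * (f w - r k * g w) : ℝ) * Complex.I) ∂Q) ^ n₂ k *
      (∫ w, Complex.exp ((a k * r k * (-g w) : ℝ) * Complex.I) ∂Q) ^ (n₁ k - n₂ k) := by
    refine (hS k).integral_eq (fun i ↦ ((hW k).hasLaw i).aemeasurable)
      (G := fun s x ↦ Complex.exp ((√(n₂ k : ℝ) * ((n₂ k : ℝ)⁻¹ * ∑ j ∈ s, f (x j) -
        (n₁ k : ℝ)⁻¹ * ∑ j, g (x j)) : ℝ) * Complex.I)) (C := 1) (fun s ↦ ?_)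
      (fun s x ↦ (Complex.norm_exp_ofReal_mul_I _).le) (fun s hs ↦ ?_)
    · fun_prop
    · rw [← hs, ← (hW k).integral_exp_sum (by fun_prop) (by fun_prop) s]
      congr with ω
      congr 3
      have h1 : ∑ j ∈ s, f (W k j ω) = ∑ j, if j ∈ s then f (W k j ω) else 0 := by simp
      rw [hs, mul_sub, ← mul_assoc, ← mul_assoc, hsq, hsq', h1, Finset.mul_sum, Finset.mul_sum,
        ← Finset.sum_sub_distrib]
      refine Finset.sum_congr rfl fun j _ ↦ ?_
      split_ifs <;> ring
  simp_rw [hfactor]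
  have hH : MemLp (fun w ↦ |f w| + |g w|) 2 Q := hf2.abs.add hg2.abs
  have hfi := hf2.integrable (by norm_num)
  have hgi := hg2.integrable (by norm_num)
  have h1 := tendsto_integral_exp_pow (Q := Q) (m := n₂) (t := a) (c := 1)
    (h := fun k w ↦ f w - r k * g w) (h' := fun w ↦ f w - ρ * g w) ha0 ?_
    (fun k ↦ (by fun_prop : Measurable _).aestronglyMeasurable) hH (.of_forall fun k w ↦ ?_)
    (fun w ↦ (hρ.mul_const _).const_sub _) (fun k ↦ ?_)
  rotate_left
  · refine tendsto_const_nhds.congr' ?_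
    filter_upwards [hn₂.eventually_gt_atTop 0] with k hk
    have : (0 : ℝ) < n₂ k := mod_cast hk
    rw [ha]
    simp only
    rw [inv_pow, Real.sq_sqrt this.le, mul_inv_cancel₀ this.ne']
  · refine (abs_sub _ _).trans ?_
    rw [abs_mul, abs_of_nonneg (hr0 k)]
    gcongr
    exact mul_le_of_le_one_left (abs_nonneg _) (hr1 k)
  · rw [integral_sub hfi (hgi.const_mul _), integral_const_mul, hf0, hg0]
    simp
  have h2 := tendsto_integral_exp_pow (Q := Q) (m := fun k ↦ n₁ k - n₂ k) (t := fun k ↦ a k * r k)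
    (c := ρ * (1 - ρ)) (h := fun k w ↦ -g w) (h' := fun w ↦ -g w) (by simpa using ha0.mul hρ) ?_
    (fun k ↦ (by fun_prop : Measurable _).aestronglyMeasurable) hH (.of_forall fun k w ↦ ?_)
    (fun w ↦ tendsto_const_nhds) (fun k ↦ by rw [integral_neg, hg0, neg_zero])
  rotate_left
  · refine (hρ.mul (hρ.const_sub 1)).congr' ?_
    filter_upwards [hn₂.eventually_gt_atTop 0] with k hk
    have h2 : (0 : ℝ) < n₂ k := mod_cast hk
    have h1 : (0 : ℝ) < n₁ k := mod_cast hk.trans_le (hle k)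
    rw [Nat.cast_sub (hle k), ha, hr]
    simp only
    rw [mul_pow, inv_pow, Real.sq_sqrt h2.le]
    field_simp
  · rw [abs_neg]
    linarith [abs_nonneg (f w)]
  have h3 := h1.mul h2
  rw [← Complex.exp_add, ← Complex.ofReal_add] at h3
  convert h3 using 4
  simp only [neg_sq]
  ring

/-! ### Observed data and stacked vectors -/

theorem measurable_outcome {𝒳 𝒰 : Type*} [MeasurableSpace 𝒳] [MeasurableSpace 𝒰] :
    Measurable (outcome : Record 𝒳 𝒰 → ℝ) := by
  unfold outcome outcome0 outcome1
  exact Measurable.ite (measurable_fst (measurableSet_singleton true)) (by fun_prop) (by fun_prop)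

theorem measurable_fullObs {𝒳 𝒰 : Type*} [MeasurableSpace 𝒳] [MeasurableSpace 𝒰] :
    Measurable (fullObs : Record 𝒳 𝒰 → _) := by
  have := measurable_outcome (𝒳 := 𝒳) (𝒰 := 𝒰)
  unfold fullObs
  fun_prop

theorem measurable_commonObs {𝒳 𝒰 : Type*} [MeasurableSpace 𝒳] [MeasurableSpace 𝒰] :
    Measurable (commonObs : Record 𝒳 𝒰 → _) := by
  have := measurable_outcome (𝒳 := 𝒳) (𝒰 := 𝒰)
  unfold commonObs
  fun_prop

theorem norm_stack_le {L : ℕ} (a : ℝ) (b : EuclideanSpace ℝ (Fin L)) :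
    ‖stack a b‖ ≤ ‖a‖ + ‖b‖ := by
  refine abs_le_of_sq_le_sq' ?_ (by positivity) |>.2
  have h : ‖stack a b‖ ^ 2 = ‖a‖ ^ 2 + ‖b‖ ^ 2 := by
    simp [EuclideanSpace.norm_sq_eq, stack]
  nlinarith [norm_nonneg a, norm_nonneg b]

theorem inner_stack {L : ℕ} (a : ℝ) (b : EuclideanSpace ℝ (Fin L))
    (x : EuclideanSpace ℝ (Unit ⊕ Fin L)) :
    inner ℝ (stack a b) x = a * x (.inl ()) + inner ℝ b (WithLp.toLp 2 fun l ↦ x (.inr l)) := by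
  simp [PiLp.inner_apply, stack, mul_comm]

theorem stack_sub_stack {L : ℕ} (a a' : ℝ) (b b' : EuclideanSpace ℝ (Fin L)) :
    stack a b - stack a' b' = stack (a - a') (b - b') := by
  ext i
  rcases i with _ | l <;> simp [stack]

theorem measurable_stack {L : ℕ} :
    Measurable fun p : ℝ × EuclideanSpace ℝ (Fin L) ↦ stack p.1 p.2 := by
  unfold stack
  refine ((PiLp.continuous_toLp 2 _).comp (continuous_pi fun i ↦ ?_)).measurable
  rcases i with _ | l <;> simp <;> fun_prop

theorem integral_inner_const_eq_zero {R E : Type*} [MeasurableSpace R] {Q : Measure R}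
    [IsFiniteMeasure Q] [NormedAddCommGroup E] [InnerProductSpace ℝ E] [CompleteSpace E]
    {φ : R → E} (hφ : MemLp φ 2 Q) (hφ0 : ∫ w, φ w ∂Q = 0) (y : E) :
    ∫ w, inner ℝ (φ w) y ∂Q = 0 := by
  simp_rw [real_inner_comm y]
  rw [integral_inner (hφ.integrable (by norm_num)), hφ0, inner_zero_right]

/-! ### The limiting covariance matrix -/

/-- The quadratic form of the limiting covariance matrix is the limiting variance of
`tendsto_integral_exp_subsample` for `g = ⟪φ, y⟫` and `f = a ψ + g`, where `x = (a, y)`. -/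
theorem dotProduct_jointCov_mulVec {R : Type*} [MeasurableSpace R] {Q : Measure R}
    [IsProbabilityMeasure Q] {L : ℕ} {ψ : R → ℝ} {φ : R → EuclideanSpace ℝ (Fin L)}
    (hψ : MemLp ψ 2 Q) (hφ : MemLp φ 2 Q) (hψ0 : ∫ w, ψ w ∂Q = 0) (hφ0 : ∫ w, φ w ∂Q = 0)
    (ρ : ℝ) (x : Unit ⊕ Fin L → ℝ) :
    x ⬝ᵥ (jointCov Var[ψ; Q] (fun l ↦ (1 - ρ) * cov[ψ, fun w ↦ φ w l; Q])
      (Matrix.of fun l m ↦ (1 - ρ) * cov[fun w ↦ φ w l, fun w ↦ φ w m; Q])).mulVec x =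
    ∫ w, (ψ w * x (.inl ()) + inner ℝ (φ w) (WithLp.toLp 2 fun l ↦ x (.inr l)) -
        ρ * inner ℝ (φ w) (WithLp.toLp 2 fun l ↦ x (.inr l))) ^ 2 ∂Q +
      ρ * (1 - ρ) * ∫ w, (inner ℝ (φ w) (WithLp.toLp 2 fun l ↦ x (.inr l))) ^ 2 ∂Q := by
  set y : EuclideanSpace ℝ (Fin L) := WithLp.toLp 2 fun l ↦ x (.inr l) with hy
  set g : R → ℝ := fun w ↦ inner ℝ (φ w) y with hg
  set u : R → ℝ := fun w ↦ ψ w * x (.inl ()) with hu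
  have hφl (l) : MemLp (fun w ↦ φ w l) 2 Q := (EuclideanSpace.proj (𝕜 := ℝ) l).comp_memLp' hφ
  have hg2 : MemLp g 2 Q := hφ.inner_const y
  have hu2 : MemLp u 2 Q := hψ.mul_const _
  have hg0 : ∫ w, g w ∂Q = 0 := integral_inner_const_eq_zero hφ hφ0 y
  have hu0 : ∫ w, u w ∂Q = 0 := by rw [hu, integral_mul_const, hψ0, zero_mul]
  have hgsum : g = fun w ↦ ∑ l, φ w l * x (.inr l) := by
    ext w
    simp [hg, hy, PiLp.inner_apply, mul_comm]
  have huu : ∫ w, u w ^ 2 ∂Q = x (.inl ()) ^ 2 * Var[ψ; Q] := by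
    have : cov[u, u; Q] = ∫ w, u w ^ 2 ∂Q := by
      simp [covariance_eq_sub hu2 hu2, hu0, sq]
    rw [← this, hu, covariance_mul_const_left, covariance_mul_const_right,
      covariance_self hψ.aemeasurable]
    ring
  have hug : ∫ w, u w * g w ∂Q = ∑ l, x (.inl ()) * x (.inr l) * cov[ψ, fun w ↦ φ w l; Q] := by
    have : cov[u, g; Q] = ∫ w, u w * g w ∂Q := by
      simp [covariance_eq_sub hu2 hg2, hu0]
    rw [← this, hu, hgsum, covariance_mul_const_left,
      covariance_fun_sum_right (fun l ↦ (hφl l).mul_const _) hψ, Finset.sum_mul]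
    simp_rw [covariance_mul_const_right]
    exact Finset.sum_congr rfl fun l _ ↦ by ring
  have hgg : ∫ w, g w ^ 2 ∂Q =
      ∑ l, ∑ m, x (.inr l) * x (.inr m) * cov[fun w ↦ φ w l, fun w ↦ φ w m; Q] := by
    have : cov[g, g; Q] = ∫ w, g w ^ 2 ∂Q := by
      simp [covariance_eq_sub hg2 hg2, hg0, sq]
    rw [← this, hgsum, covariance_fun_sum_fun_sum (fun l ↦ (hφl l).mul_const _)
      (fun l ↦ (hφl l).mul_const _)]
    simp_rw [covariance_mul_const_left, covariance_mul_const_right]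
    exact Finset.sum_congr rfl fun l _ ↦ Finset.sum_congr rfl fun m _ ↦ by ring
  -- expand the square of `u + (1 - ρ) g`
  have hexp : ∫ w, (u w + g w - ρ * g w) ^ 2 ∂Q = ∫ w, u w ^ 2 ∂Q +
      2 * (1 - ρ) * ∫ w, u w * g w ∂Q + (1 - ρ) ^ 2 * ∫ w, g w ^ 2 ∂Q := by
    have h1 : Integrable (fun w ↦ 2 * (1 - ρ) * (u w * g w)) Q :=
      (hu2.integrable_mul hg2).const_mul _
    have h2 : Integrable (fun w ↦ (1 - ρ) ^ 2 * g w ^ 2) Q := hg2.integrable_sq.const_mul _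
    rw [← integral_const_mul, ← integral_const_mul, ← integral_add hu2.integrable_sq h1,
      ← integral_add (f := fun w ↦ u w ^ 2 + 2 * (1 - ρ) * (u w * g w))
        (hu2.integrable_sq.add h1) h2]
    congr with w
    ring
  have hquad : ∫ w, (u w + g w - ρ * g w) ^ 2 ∂Q + ρ * (1 - ρ) * ∫ w, g w ^ 2 ∂Q =
      ∫ w, u w ^ 2 ∂Q + 2 * (1 - ρ) * ∫ w, u w * g w ∂Q + (1 - ρ) * ∫ w, g w ^ 2 ∂Q := by
    rw [hexp]
    ring
  rw [hquad, huu, hug, hgg]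
  simp only [jointCov, dotProduct, Matrix.mulVec, Fintype.sum_sum_type, Matrix.fromBlocks_apply₁₁,
    Matrix.fromBlocks_apply₁₂, Matrix.fromBlocks_apply₂₁, Matrix.fromBlocks_apply₂₂,
    Matrix.of_apply,
    Matrix.replicateRow_apply, Matrix.replicateCol_apply, Finset.univ_unique, Finset.sum_singleton,
    mul_add, Finset.mul_sum, Finset.sum_add_distrib]
  have e1 : ∑ l, x (.inl ()) * ((1 - ρ) * cov[ψ, fun w ↦ φ w l; Q] * x (.inr l)) +
      ∑ l, x (.inr l) * ((1 - ρ) * cov[ψ, fun w ↦ φ w l; Q] * x (.inl ())) =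
      ∑ l, 2 * (1 - ρ) * (x (.inl ()) * x (.inr l) * cov[ψ, fun w ↦ φ w l; Q]) := by
    rw [← Finset.sum_add_distrib]
    exact Finset.sum_congr rfl fun l _ ↦ by ring
  have e2 : ∑ l, ∑ m, x (.inr l) *
      ((1 - ρ) * cov[fun w ↦ φ w l, fun w ↦ φ w m; Q] * x (.inr m)) =
      ∑ l, ∑ m, (1 - ρ) * (x (.inr l) * x (.inr m) * cov[fun w ↦ φ w l, fun w ↦ φ w m; Q]) :=
    Finset.sum_congr rfl fun l _ ↦ Finset.sum_congr rfl fun m _ ↦ by ring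
  rw [← e1, ← e2]
  change _ + _ + (_ + _) = _
  simp only [PUnit.default_eq_unit]
  ring

theorem posSemidef_jointCov {R : Type*} [MeasurableSpace R] {Q : Measure R}
    [IsProbabilityMeasure Q] {L : ℕ} {ψ : R → ℝ} {φ : R → EuclideanSpace ℝ (Fin L)}
    (hψ : MemLp ψ 2 Q) (hφ : MemLp φ 2 Q) (hψ0 : ∫ w, ψ w ∂Q = 0) (hφ0 : ∫ w, φ w ∂Q = 0)
    {ρ : ℝ} (h0 : 0 ≤ ρ) (h1 : ρ ≤ 1) :
    (jointCov Var[ψ; Q] (fun l ↦ (1 - ρ) * cov[ψ, fun w ↦ φ w l; Q])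
      (Matrix.of fun l m ↦ (1 - ρ) * cov[fun w ↦ φ w l, fun w ↦ φ w m; Q])).PosSemidef := by
  refine .of_dotProduct_mulVec_nonneg ?_ fun x ↦ ?_
  · ext i j
    rcases i with _ | i <;> rcases j with _ | j <;>
      simp [jointCov, covariance_comm]
  · rw [star_trivial, dotProduct_jointCov_mulVec hψ hφ hψ0 hφ0]
    have := sub_nonneg.2 h1
    positivity

/-! ### Convergence in distribution -/

/-- The joint central limit theorem for the linear part of the estimators. -/
theorem tendstoInDistribution_stack_subsample {Ω R : Type*} [MeasurableSpace Ω] [MeasurableSpace R]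
    {P : Measure Ω} [IsProbabilityMeasure P] {Q : Measure R} [IsProbabilityMeasure Q]
    {n₁ n₂ : ℕ → ℕ} (hn₂ : Tendsto n₂ atTop atTop) {ρ : ℝ}
    (hρ : Tendsto (fun k ↦ (n₂ k : ℝ) / (n₁ k : ℝ)) atTop (𝓝 ρ)) (h0 : 0 ≤ ρ) (h1 : ρ ≤ 1)
    {W : (k : ℕ) → Fin (n₁ k) → Ω → R} (hW : ∀ k, IsIIDSample P Q (W k))
    {S : (k : ℕ) → Ω → Finset (Fin (n₁ k))} (hS : ∀ k, IsSimpleRandomSample P (n₂ k) (S k) (W k))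
    {L : ℕ} {ψ : R → ℝ} {φ : R → EuclideanSpace ℝ (Fin L)} (hψm : Measurable ψ) (hφm : Measurable φ)
    (hψ : MemLp ψ 2 Q) (hφ : MemLp φ 2 Q) (hψ0 : ∫ w, ψ w ∂Q = 0) (hφ0 : ∫ w, φ w ∂Q = 0) :
    TendstoInDistribution (fun k ω ↦ √(n₂ k : ℝ) •
        stack ((n₂ k : ℝ)⁻¹ • ∑ j ∈ S k ω, ψ (W k j ω))
          ((n₂ k : ℝ)⁻¹ • ∑ j ∈ S k ω, φ (W k j ω) - (n₁ k : ℝ)⁻¹ • ∑ j, φ (W k j ω)))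
      atTop id (fun _ ↦ P)
      (multivariateGaussian 0
        (jointCov Var[ψ; Q] (fun l ↦ (1 - ρ) * cov[ψ, fun w ↦ φ w l; Q])
          (Matrix.of fun l m ↦ (1 - ρ) * cov[fun w ↦ φ w l, fun w ↦ φ w m; Q]))) := by
  have hWm (k) (i) : AEMeasurable (W k i) P := ((hW k).hasLaw i).aemeasurable
  have hXm (k) : AEMeasurable (fun ω ↦ √(n₂ k : ℝ) •
      stack ((n₂ k : ℝ)⁻¹ • ∑ j ∈ S k ω, ψ (W k j ω))
        ((n₂ k : ℝ)⁻¹ • ∑ j ∈ S k ω, φ (W k j ω) - (n₁ k : ℝ)⁻¹ • ∑ j, φ (W k j ω))) P := by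
    have h1 := (hS k).aemeasurable_sum (hWm k) hψm
    have h2 := (hS k).aemeasurable_sum (hWm k) hφm
    have h3 : AEMeasurable (fun ω ↦ ∑ j, φ (W k j ω)) P :=
      Finset.aemeasurable_fun_sum _ fun j _ ↦ hφm.comp_aemeasurable (hWm k j)
    have h4 := measurable_stack.comp_aemeasurable
      ((h1.const_smul (n₂ k : ℝ)⁻¹).prodMk
        ((h2.const_smul (n₂ k : ℝ)⁻¹).sub (h3.const_smul (n₁ k : ℝ)⁻¹)))
    exact h4.const_smul √(n₂ k : ℝ)
  refine ⟨hXm, by fun_prop, ProbabilityMeasure.tendsto_iff_tendsto_charFun.2 fun x ↦ ?_⟩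
  set y : EuclideanSpace ℝ (Fin L) := WithLp.toLp 2 fun l ↦ x (.inr l) with hy
  have hgm : Measurable fun w ↦ inner ℝ (φ w) y := hφm.inner_const
  have hg2 : MemLp (fun w ↦ inner ℝ (φ w) y) 2 Q := hφ.inner_const y
  have hu2 : MemLp (fun w ↦ ψ w * x (.inl ())) 2 Q := hψ.mul_const _
  have hg0 : ∫ w, inner ℝ (φ w) y ∂Q = 0 := integral_inner_const_eq_zero hφ hφ0 y
  have hf0 : ∫ w, (ψ w * x (.inl ()) + inner ℝ (φ w) y) ∂Q = 0 := by
    rw [integral_add (hu2.integrable (by norm_num)) (hg2.integrable (by norm_num)), hg0,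
      integral_mul_const, hψ0]
    simp
  have key := tendsto_integral_exp_subsample hn₂ hρ hW hS
    (f := fun w ↦ ψ w * x (.inl ()) + inner ℝ (φ w) y) (by fun_prop) hgm (hu2.add hg2) hg2 hf0 hg0
  simp only [ProbabilityMeasure.coe_mk, Measure.map_id]
  rw [charFun_multivariateGaussian (posSemidef_jointCov hψ hφ hψ0 hφ0 h0 h1)]
  convert key using 2 with k
  · rw [charFun_apply, integral_map (hXm k) (by fun_prop)]
    congr with ω
    congr 3
    simp only [real_inner_smul_left, inner_stack, ← hy, inner_sub_left, sum_inner, smul_eq_mul,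
      Finset.sum_add_distrib, ← Finset.sum_mul]
    ring
  · rw [← dotProduct_jointCov_mulVec hψ hφ hψ0 hφ0, inner_zero_right]
    congr 1
    push_cast
    ring

theorem tendstoInMeasure_zero_of_norm_le_add_add {Ω E F G H : Type*} [MeasurableSpace Ω]
    {P : Measure Ω} [NormedAddCommGroup E] [NormedAddCommGroup F] [NormedAddCommGroup G]
    [NormedAddCommGroup H] {Z : ℕ → Ω → E} {A : ℕ → Ω → F} {B : ℕ → Ω → G} {C : ℕ → Ω → H}
    (hA : TendstoInMeasure P A atTop (fun _ ↦ 0)) (hB : TendstoInMeasure P B atTop (fun _ ↦ 0))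
    (hC : TendstoInMeasure P C atTop (fun _ ↦ 0))
    (hZ : ∀ k ω, ‖Z k ω‖ ≤ ‖A k ω‖ + ‖B k ω‖ + ‖C k ω‖) :
    TendstoInMeasure P Z atTop (fun _ ↦ 0) := by
  rw [tendstoInMeasure_iff_norm] at *
  intro ε hε
  have h := ((hA (ε / 3) (by positivity)).add (hB (ε / 3) (by positivity))).add
    (hC (ε / 3) (by positivity))
  simp only [sub_zero, add_zero] at h ⊢
  refine tendsto_of_tendsto_of_tendsto_of_le_of_le tendsto_const_nhds h (fun _ ↦ zero_le)
    fun k ↦ ?_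
  refine (measure_mono fun ω hω ↦ ?_).trans
    ((measure_union_le _ _).trans (add_le_add_left (measure_union_le _ _) _))
  simp only [Set.mem_ofPred_eq, Set.mem_union] at hω ⊢
  by_contra! hcon
  linarith [hZ k ω]

theorem mainTheorem2
    {Ω 𝒳 𝒰 : Type*} [MeasurableSpace Ω] [MeasurableSpace 𝒳] [MeasurableSpace 𝒰]
    (P : Measure Ω) [IsProbabilityMeasure P]
    -- superpopulation law of `(A, X, U, Y(0), Y(1))`, for which the causal effect exists
    (Q : Measure (Record 𝒳 𝒰)) [IsProbabilityMeasure Q]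
    (hQ : Integrable (fun w ↦ outcome1 w - outcome0 w) Q)
    -- the `k`-th study: `n₁ k` i.i.d. units, of which `n₂ k` are drawn at random for validation
    (n₁ n₂ : ℕ → ℕ) (hn₂ : Tendsto n₂ atTop atTop)
    (ρ : ℝ) (hρ : Tendsto (fun k ↦ (n₂ k : ℝ) / (n₁ k : ℝ)) atTop (𝓝 ρ))
    (W : (k : ℕ) → Fin (n₁ k) → Ω → Record 𝒳 𝒰) (hW : ∀ k, IsIIDSample P Q (W k))
    (S₂ : (k : ℕ) → Ω → Finset (Fin (n₁ k)))
    (hS₂ : ∀ k, IsSimpleRandomSample P (n₂ k) (S₂ k) (W k))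
    -- the initial estimator, from the validation sample
    (ψ : Bool × 𝒳 × 𝒰 × ℝ → ℝ) (τhat₂ : ℕ → Ω → ℝ)
    (hτ₂ : IsAsympLinear P Q W n₂ S₂ fullObs ψ (averageCausalEffect Q) τhat₂)
    -- the error-prone estimators, from the main and from the validation sample
    {L : ℕ} (φ : Bool × 𝒳 × ℝ → EuclideanSpace ℝ (Fin L)) (τep : EuclideanSpace ℝ (Fin L))
    (τhat₁ep τhat₂ep : ℕ → Ω → EuclideanSpace ℝ (Fin L))
    (hτ₁ep : IsAsympLinear P Q W n₁ (fun _ _ ↦ Finset.univ) commonObs φ τep τhat₁ep)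
    (hτ₂ep : IsAsympLinear P Q W n₂ S₂ commonObs φ τep τhat₂ep) :
    (jointCov (limitV2 Q ψ) (limitΓ Q ρ ψ φ) (limitV Q ρ φ)).PosSemidef ∧
    TendstoInDistribution
      (fun k ω ↦ √(n₂ k : ℝ) •
        stack (τhat₂ k ω - averageCausalEffect Q) (τhat₂ep k ω - τhat₁ep k ω))
      atTop id (fun _ ↦ P)
      (multivariateGaussian 0
        (jointCov (limitV2 Q ψ) (limitΓ Q ρ ψ φ) (limitV Q ρ φ))) := by
  have hle (k) : n₂ k ≤ n₁ k := (hS₂ k).card_le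
  have hρ0 : 0 ≤ ρ := ge_of_tendsto' hρ fun k ↦ by positivity
  have hρ1 : ρ ≤ 1 := le_of_tendsto' hρ fun k ↦
    div_le_one_of_le₀ (mod_cast hle k) (by positivity)
  refine ⟨posSemidef_jointCov hτ₂.memLp_influence hτ₁ep.memLp_influence hτ₂.mean_influence
    hτ₁ep.mean_influence hρ0 hρ1, ?_⟩
  refine tendstoInDistribution_of_tendstoInMeasure_sub _ _
    (tendstoInDistribution_stack_subsample hn₂ hρ hρ0 hρ1 hW hS₂
      (hτ₂.measurable_influence.comp measurable_fullObs)
      (hτ₁ep.measurable_influence.comp measurable_commonObs) hτ₂.memLp_influence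
      hτ₁ep.memLp_influence hτ₂.mean_influence hτ₁ep.mean_influence) ?_ fun k ↦ ?_
  · refine tendstoInMeasure_zero_of_norm_le_add_add hτ₂.expansion hτ₂ep.expansion hτ₁ep.expansion
      fun k ω ↦ ?_
    rw [Pi.sub_apply, Pi.sub_apply, ← smul_sub, stack_sub_stack, norm_smul, norm_smul, norm_smul,
      norm_smul, Real.norm_of_nonneg (Real.sqrt_nonneg _), Real.norm_of_nonneg (Real.sqrt_nonneg _)]
    have hsqrt : √(n₂ k : ℝ) ≤ √(n₁ k : ℝ) := Real.sqrt_le_sqrt (mod_cast hle k)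
    rw [add_assoc]
    refine (mul_le_mul_of_nonneg_left (norm_stack_le _ _) (Real.sqrt_nonneg _)).trans ?_
    rw [mul_add]
    gcongr
    -- centring at `τep` is immaterial in the difference of the error-prone estimators
    have hsub (a b c d θ : EuclideanSpace ℝ (Fin L)) :
        a - b - (c - d) = (a - θ - c) - (b - θ - d) := by abel
    rw [hsub _ _ _ _ τep]
    refine (mul_le_mul_of_nonneg_left (norm_sub_le _ _) (Real.sqrt_nonneg _)).trans ?_
    rw [mul_add]
    gcongr
  · have h1 := hτ₂.aemeasurable_est k
    have h2 := hτ₁ep.aemeasurable_est k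
    have h3 := hτ₂ep.aemeasurable_est k
    have h4 := measurable_stack.comp_aemeasurable
      ((h1.sub_const (averageCausalEffect Q)).prodMk (h3.sub h2))
    exact h4.const_smul √(n₂ k : ℝ)
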